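/- **Theorem.** The first-order theories $\mathsf{ID}$ and $\mathsf{ID}^{*}$ are mutually interpretable. Here, for a nonempty binary string $\alpha$, the biteral $\overline{\alpha}$ is the closed term over the constants $0,1$ and the binary function symbol $\circ$ (written as juxtaposition) given by $\overline{\boldsymbol 0}=0$, $\overline{\boldsymbol 1}=1$, $\overline{\alpha\boldsymbol 0}=(\overline{\alpha}\,0)$, $\overline{\alpha\boldsymbol 1}=(\overline{\alpha}\,1)$; $\mathsf{Pref}(\alpha)$ and $\mathsf{Sub}(\alpha)$ are the sets of nonempty prefixes and of nonempty (contiguous) substrings of $\alpha$; and $x\sqsubseteq_{\mathsf s}y$ abbreviates $x=y\vee\exists u v\,[\,y=ux\vee y=xv\vee y=uxv\,]$. The theory $\mathsf{ID}$, in the language $\{0,1,\circ,\preceq\}$ with $\preceq$ a binary relation symbol, has the non-logical axioms - $\mathsf{ID}_1$: $\forall xyz\,[(xy)z=x(yz)]$; - $\mathsf{ID}_2$: $\forall xy\,[x\neq y\to(x0\neq y0\wedge x1\neq y1)]$; - $\mathsf{ID}_3$: $\forall xy\,[x0\neq y1]$; - $\mathsf{ID}_4$: $\forall x\,[x\preceq\overline{\alpha}\leftrightarrow\bigvee_{\gamma\in\mathsf{Pref}(\alpha)}x=\overline{\gamma}]$,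 for each nonempty binary string $\alpha$. The theory $\mathsf{ID}^{*}$ has the axioms $\mathsf{ID}_1,\mathsf{ID}_2,\mathsf{ID}_3$ and - $\mathsf{ID}_4^{*}$: $\forall x\,[x\sqsubseteq_{\mathsf s}\overline{\alpha}\to\bigvee_{\gamma\in\mathsf{Sub}(\alpha)}x=\overline{\gamma}]$, for each nonempty binary string $\alpha$. The statement holds both when the language of $\mathsf{ID}^{*}$ is $\{0,1,\circ\}$ and when it is $\{0,1,\circ,\preceq\}$. Interpretability is many-dimensional, parameter-free, one-piece relative interpretability. A translation $\tau$ from a language $\mathcal L_1$ to a language $\mathcal L_2$ consists of a dimension $m\ge 1$, a domain formula $\delta(x_1,\dots,x_m)$, and a formula $\psi_R$, $\psi_f$ for every relation symbol (including equality) and every function or constant symbol of $\mathcal L_1$; variables become $m$-tuples, terms are translated through the graphs $\psi_f$, quantifiers are relativized to $\delta$, and $\tau$ commutes with the connectives. An $\mathcal L_1$-theory $S$ is interpretable in an $\mathcal L_2$-theory $T$ if for some such $\tau$ the theory $T$ proves $\exists\vec x\,\delta(\vec x)$, proves $\bigwedge_i\delta(\vec x_i)\to\exists!\vec y\,[\delta(\vec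 y)\wedge\psi_f(\vec x_1,\dots,\vec x_n,\vec y)]$ for all function and constant symbols $f$ of $\mathcal L_1$, and proves the translations of the equality axioms and of all non-logical axioms of $S$. $S$ and $T$ are mutually interpretable if each is interpretable in the other. -/

import Mathlib

open FirstOrder FirstOrder.Language

/-! ### Relative translations and interpretations

Provability `T ⊢ φ` of first-order logic with equality is Mathlib's consequence relation `T ⊨ᵇ φ`
(the universal closure of `φ` holds in all nonempty models of `T`). -/

/-- A many-dimensional, parameter-free, one-piece relative translation from `L₁` to `L₂`.
Variables are replaced by `dim`-tuples of variables. Equality is treated as a binary relation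
symbol, and constant symbols are the function symbols of arity `0`. -/
structure RelTranslation (L₁ L₂ : FirstOrder.Language.{0, 0}) where
  /-- the length of the tuples -/
  dim : ℕ
  dim_pos : 0 < dim
  /-- the domain formula `δ` -/
  dom : L₂.Formula (Fin dim)
  /-- the formula that translates equality -/
  eq : L₂.Formula (Fin 2 × Fin dim)
  /-- the formulas `ψ_R`; the variable `(j, i)` is the `i`-th entry of the `j`-th tuple -/
  rel : ∀ {n : ℕ}, L₁.Relations n → L₂.Formula (Fin n × Fin dim)
  /-- the formulas `ψ_f`; the variables `Sum.inr i` form the tuple of the value -/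
  fn : ∀ {n : ℕ}, L₁.Functions n → L₂.Formula ((Fin n × Fin dim) ⊕ Fin dim)

namespace RelTranslation

variable {L₁ L₂ : FirstOrder.Language.{0, 0}}

/-- The formula `(t)^{τ, w}` saying that the tuple `w` (the variables `Sum.inr i`) is the value of
the term `t`; the variable `x` of `t` becomes the tuple of the variables `Sum.inl (x, i)`. -/
noncomputable def term (τ : RelTranslation L₁ L₂) {α : Type} :
    L₁.Term α → L₂.Formula ((α × Fin τ.dim) ⊕ Fin τ.dim)
  | .var x => Formula.iInf fun i : Fin τ.dim =>
      Term.equal (Term.var (Sum.inr i)) (Term.var (Sum.inl (x, i)))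
  | @Term.func _ _ n f ts => Formula.iExs (Fin n × Fin τ.dim)
      ((Formula.iInf fun j : Fin n => τ.dom.relabel fun i => Sum.inr (j, i)) ⊓
        (Formula.iInf fun j : Fin n => (τ.term (ts j)).relabel
          (Sum.elim (fun p => Sum.inl (Sum.inl p)) (fun i => Sum.inr (j, i)))) ⊓
        (τ.fn f).relabel (Sum.elim (fun p => Sum.inr p) (fun i => Sum.inl (Sum.inr i))))

/-- The translation `∃ v₁ … vₙ [⋀ δ(vⱼ) ∧ ⋀ (tⱼ)^{τ, vⱼ} ∧ ψ(v₁, …, vₙ)]` of an atomic formula. -/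
noncomputable def atomic (τ : RelTranslation L₁ L₂) {α : Type} {n : ℕ}
    (ψ : L₂.Formula (Fin n × Fin τ.dim)) (ts : Fin n → L₁.Term α) :
    L₂.Formula (α × Fin τ.dim) :=
  Formula.iExs (Fin n × Fin τ.dim)
    ((Formula.iInf fun j : Fin n => τ.dom.relabel fun i => Sum.inr (j, i)) ⊓
      (Formula.iInf fun j : Fin n => (τ.term (ts j)).relabel
        (Sum.elim Sum.inl (fun i => Sum.inr (j, i)))) ⊓
      ψ.relabel Sum.inr)

/-- Renaming of variables that separates the tuple of the last bound variable from the others. -/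
def splitLast {α : Type} {n m : ℕ} :
    (α ⊕ Fin (n + 1)) × Fin m → ((α ⊕ Fin n) × Fin m) ⊕ Fin m
  | (Sum.inl a, i) => Sum.inl (Sum.inl a, i)
  | (Sum.inr k, i) =>
      Fin.lastCases (motive := fun _ => ((α ⊕ Fin n) × Fin m) ⊕ Fin m)
        (Sum.inr i) (fun k' => Sum.inl (Sum.inr k', i)) k

/-- The translation `φ^τ` of formulas. It commutes with `⊥` and `→`, and
`(∀ x φ)^τ` is `∀ x⃗ [δ(x⃗) → φ^τ]`; the other connectives and `∃` are defined from these. -/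
noncomputable def formula (τ : RelTranslation L₁ L₂) {α : Type} :
    {n : ℕ} → L₁.BoundedFormula α n → L₂.Formula ((α ⊕ Fin n) × Fin τ.dim)
  | _, .falsum => ⊥
  | _, .equal t₁ t₂ => τ.atomic τ.eq ![t₁, t₂]
  | _, .rel R ts => τ.atomic (τ.rel R) ts
  | _, .imp φ ψ => (τ.formula φ).imp (τ.formula ψ)
  | _, .all φ => Formula.iAlls (Fin τ.dim)
      ((τ.dom.relabel Sum.inr).imp ((τ.formula φ).relabel splitLast))

end RelTranslation

/-- The equality axioms of the language `L`: reflexivity, symmetry, transitivity, and congruence for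
all function symbols and all relation symbols. -/
inductive EqualityAxiom (L : FirstOrder.Language.{0, 0}) : L.Sentence → Prop
  | refl : EqualityAxiom L (∀' (&0 =' &0))
  | symm : EqualityAxiom L (∀' ∀' ((&0 =' &1) ⟹ (&1 =' &0)))
  | trans : EqualityAxiom L (∀' ∀' ∀' ((&0 =' &1) ⟹ ((&1 =' &2) ⟹ (&0 =' &2))))
  | congrFn {n : ℕ} (f : L.Functions n) : EqualityAxiom L
      (Formula.iAlls (Fin n ⊕ Fin n)
        ((Formula.iInf fun j : Fin n => Term.equal
          (Term.var (Sum.inr (Sum.inl j))) (Term.var (Sum.inr (Sum.inr j)))).imp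
        (Term.equal (Term.func f fun j => Term.var (Sum.inr (Sum.inl j)))
          (Term.func f fun j => Term.var (Sum.inr (Sum.inr j))))))
  | congrRel {n : ℕ} (R : L.Relations n) : EqualityAxiom L
      (Formula.iAlls (Fin n ⊕ Fin n)
        ((Formula.iInf fun j : Fin n => Term.equal
          (Term.var (Sum.inr (Sum.inl j))) (Term.var (Sum.inr (Sum.inr j)))).imp
        ((R.formula fun j => Term.var (Sum.inr (Sum.inl j))).imp
          (R.formula fun j => Term.var (Sum.inr (Sum.inr j))))))

/-- The translation `τ` is an interpretation of the theory `S` in the theory `T`. -/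
structure RelTranslation.IsInterpretation {L₁ L₂ : FirstOrder.Language.{0, 0}}
    (τ : RelTranslation L₁ L₂) (S : L₁.Theory) (T : L₂.Theory) : Prop where
  /-- `T ⊢ ∃ x⃗ δ(x⃗)` -/
  dom_nonempty : T ⊨ᵇ (Formula.iExs (Fin τ.dim) (τ.dom.relabel Sum.inr) : L₂.Sentence)
  /-- `T ⊢ ⋀ δ(x⃗ⱼ) → ∃! y⃗ [δ(y⃗) ∧ ψ_f(x⃗₁, …, x⃗ₙ, y⃗)]`, for constants as well -/
  fn_total : ∀ {n : ℕ} (f : L₁.Functions n),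
    T ⊨ᵇ ((Formula.iInf fun j : Fin n => τ.dom.relabel fun i => (j, i)).imp
      (Formula.iExsUnique (Fin τ.dim) (τ.dom.relabel Sum.inr ⊓ τ.fn f)) :
        L₂.Formula (Fin n × Fin τ.dim))
  /-- `T` proves the translation of the equality axioms; this is automatic if equality is
  translated as equality. -/
  eq_axioms : ∀ φ : L₁.Sentence, EqualityAxiom L₁ φ → T ⊨ᵇ τ.formula φ
  /-- `T` proves the translation of the non-logical axioms of `S`. -/
  axioms : ∀ φ ∈ S, T ⊨ᵇ τ.formula φ

/-- `S` is relatively interpretable in `T`. -/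
def Interpretable {L₁ L₂ : FirstOrder.Language.{0, 0}} (S : L₁.Theory) (T : L₂.Theory) : Prop :=
  ∃ τ : RelTranslation L₁ L₂, τ.IsInterpretation S T

/-- `S` and `T` are mutually interpretable. -/
def MutuallyInterpretable {L₁ L₂ : FirstOrder.Language.{0, 0}}
    (S : L₁.Theory) (T : L₂.Theory) : Prop :=
  Interpretable S T ∧ Interpretable T S

/-! ### Theories of concatenation -/

/-- The function symbols: the constants `0`, `1` and the binary concatenation symbol. -/
inductive ConcatFn : ℕ → Type
  | zero : ConcatFn 0
  | one : ConcatFn 0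
  | conc : ConcatFn 2

/-- The only relation symbol: the binary symbol `⪯`. -/
inductive PrefixRel : ℕ → Type
  | prec : PrefixRel 2

/-- The language with function symbols `0`, `1`, `∘` and with the relation symbols `R`. -/
abbrev concatLang (R : ℕ → Type) : FirstOrder.Language.{0, 0} := ⟨ConcatFn, R⟩

/-- The language `{0, 1, ∘}`. -/
abbrev LBTminus : FirstOrder.Language.{0, 0} := concatLang fun _ => Empty

/-- The language `{0, 1, ∘, ⪯}`. -/
abbrev LBT : FirstOrder.Language.{0, 0} := concatLang PrefixRel

namespace Concat

variable {R : ℕ → Type} {β : Type}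

/-- The constant symbols `0` (for `false`) and `1` (for `true`), as terms. -/
def bit : Bool → (concatLang R).Term β
  | false => Constants.term (L := concatLang R) ConcatFn.zero
  | true => Constants.term (L := concatLang R) ConcatFn.one

/-- The term `s ∘ t`. -/
def conc (s t : (concatLang R).Term β) : (concatLang R).Term β :=
  Functions.apply₂ (L := concatLang R) ConcatFn.conc s t

/-- The biteral of a nonempty binary string: the biteral of a single letter is the constant symbol,
and the biteral of `α b` is `(biteral α) ∘ b`. (The value at the empty string is never used.) -/
def biteral : List Bool → (concatLang R).Term β
  | [] => bit false
  | a :: l => l.foldl (fun t b => conc t (bit b)) (bit a)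

/-- The set of all nonempty prefixes of `α`. -/
def Pref (α : List Bool) : Set (List Bool) := {γ | γ ≠ [] ∧ γ <+: α}

/-- The set of all nonempty substrings (contiguous subwords) of `α`. -/
def Sub (α : List Bool) : Set (List Bool) := {γ | γ ≠ [] ∧ γ <:+: α}

instance finite_Sub (α : List Bool) : Finite (Sub α) :=
  ((List.finite_toSet α.sublists).subset fun _ h => List.mem_sublists.2 h.2.sublist).to_subtype

instance finite_Pref (α : List Bool) : Finite (Pref α) :=
  ((List.finite_toSet α.sublists).subset fun _ h => List.mem_sublists.2 h.2.sublist).to_subtype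

/-- `∀ x y z [(x y) z = x (y z)]` -/
def ax1 : (concatLang R).Sentence :=
  ∀' ∀' ∀' (conc (conc (&0) (&1)) (&2) =' conc (&0) (conc (&1) (&2)))

/-- `∀ x y [x ≠ y → (x 0 ≠ y 0 ∧ x 1 ≠ y 1)]` -/
def ax2 : (concatLang R).Sentence :=
  ∀' ∀' (∼(&0 =' &1) ⟹
    (∼(conc (&0) (bit false) =' conc (&1) (bit false)) ⊓
      ∼(conc (&0) (bit true) =' conc (&1) (bit true))))

/-- `∀ x y [x 0 ≠ y 1]` -/
def ax3 : (concatLang R).Sentence :=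
  ∀' ∀' ∼(conc (&0) (bit false) =' conc (&1) (bit true))

/-- `∀ x [x ⪯ α ↔ ⋁_{γ ∈ Pref α} x = γ]`, where strings stand for their biterals -/
noncomputable def ax4 (α : List Bool) : LBT.Sentence :=
  ∀' ((Relations.boundedFormula₂ (L := LBT) PrefixRel.prec (&0) (biteral α)) ⇔
    BoundedFormula.iSup fun γ : Pref α => (&0 =' biteral γ.1))

/-- `x ⊑ α`, that is `x = α ∨ ∃ u v [α = u x ∨ α = x v ∨ α = u x v]`, where `x`, `u`, `v` are the
bound variables `&0`, `&1`, `&2` and `α` stands for its biteral -/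
def substringOf (α : List Bool) : (concatLang R).BoundedFormula Empty 1 :=
  (&0 =' biteral α) ⊔
    ∃' ∃' ((biteral α =' conc (&1) (&0)) ⊔ (biteral α =' conc (&0) (&2)) ⊔
      (biteral α =' conc (conc (&1) (&0)) (&2)))

/-- `∀ x [x ⊑ α → ⋁_{γ ∈ Sub α} x = γ]`, where strings stand for their biterals -/
noncomputable def ax4Star (α : List Bool) : (concatLang R).Sentence :=
  ∀' (substringOf α ⟹ BoundedFormula.iSup fun γ : Sub α => (&0 =' biteral γ.1))

end Concat

open Concat in
/-- The theory `ID` in the language `{0, 1, ∘, ⪯}`. -/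
def ID : LBT.Theory :=
  {ax1, ax2, ax3} ∪ {φ | ∃ α : List Bool, α ≠ [] ∧ φ = ax4 α}

open Concat in
/-- The theory `ID*` in the language `{0, 1, ∘}` extended by the relation symbols `R`, which do not
occur in its non-logical axioms. -/
def IDStar (R : ℕ → Type) : (concatLang R).Theory :=
  {ax1, ax2, ax3} ∪ {φ | ∃ α : List Bool, α ≠ [] ∧ φ = ax4Star α}

/-! ### Semantic criterion for interpretations -/

/-! Provability is semantic consequence here, so it suffices that one translation defines, inside
every model of one theory, a model of the other (`isInterpretation_of_isInner`). Both
interpretations keep equality and the function symbols.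

For `ID` in `ID*`, read `x ⪯ y` as "`x` equals `y` or is a left factor of `y`". In `ID*` the factors
of a biteral are biterals, and distinct strings have distinct biterals, so below a biteral this is
the prefix relation (`left_factor_iff_prefix`).

For `ID*` in `ID`, one needs a definable subsemigroup that contains 0 and 1 and in which a product
equal to a biteral has only biteral factors (`InDomain.mul`, `InDomain.isStd_of_mul`); axioms 1-3
are universal and pass to it. The obstacle is that `⪯` is controlled only below biterals and that
"biteral" is not given by a formula. Hence the conditions quantify over all `g` with a definable
property (`PredClosed`, `MulClosed`) that every biteral has, so that any biteral may later be
substituted for `g`. From a string-like element last letters can be stripped inside the set of its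
`⪯`-predecessors, so induction on the length of a string shows that a string-like right factor of a
biteral is a biteral. Nothing in the definition makes a product of string-like elements string-like.
Remote elements, which never end anything below a `MulClosed` `g`, absorb the failures: if `x * y`
is not remote, some such `g` witnesses this and forces `x * y` to be string-like. The axioms do not
exclude an `x` with `x0 = 0`. Such an `x` is a right identity; `WeakLe` admits right identities in
the place of the empty string. -/

namespace RelTranslation

variable {L₁ L₂ : FirstOrder.Language.{0, 0}}

/-- The map `e` identifies the `L₁`-structure `N` with the structure that the translation `τ`
defines on tuples of elements of the `L₂`-structure `M`. -/
structure IsInner (τ : RelTranslation L₁ L₂) {M N : Type} [L₂.Structure M] [L₁.Structure N]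
    (e : N → Fin τ.dim → M) : Prop where
  injective : Function.Injective e
  realize_dom : ∀ w : Fin τ.dim → M, τ.dom.Realize w ↔ ∃ a, e a = w
  realize_eq : ∀ a : Fin 2 → N, τ.eq.Realize (fun p => e (a p.1) p.2) ↔ a 0 = a 1
  realize_rel : ∀ {n : ℕ} (R : L₁.Relations n) (a : Fin n → N),
    (τ.rel R).Realize (fun p => e (a p.1) p.2) ↔ Structure.RelMap R a
  realize_fn : ∀ {n : ℕ} (f : L₁.Functions n) (a : Fin n → N) (b : N),
    (τ.fn f).Realize (Sum.elim (fun p => e (a p.1) p.2) (e b)) ↔ b = Structure.funMap f a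

namespace IsInner

variable {τ : RelTranslation L₁ L₂} {M N : Type} [L₂.Structure M] [L₁.Structure N]
  {e : N → Fin τ.dim → M}

/-- Turns the relativized quantifier over blocks of tuples in the translation of terms and atomic
formulas into a quantifier over `N`. -/
theorem exists_tuple (h : τ.IsInner e) {n : ℕ} (P : (Fin n × Fin τ.dim → M) → Prop) :
    (∃ w : Fin n × Fin τ.dim → M, (∀ j, τ.dom.Realize fun i => w (j, i)) ∧ P w) ↔
      ∃ a : Fin n → N, P fun p => e (a p.1) p.2 := by
  constructor
  · rintro ⟨w, hw, hP⟩
    choose a ha using fun j => (h.realize_dom _).1 (hw j)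
    refine ⟨a, ?_⟩
    have : (fun p : Fin n × Fin τ.dim => e (a p.1) p.2) = w := by
      funext p
      exact congrFun (ha p.1) p.2
    rwa [this]
  · rintro ⟨a, hP⟩
    exact ⟨_, fun j => (h.realize_dom _).2 ⟨a j, rfl⟩, hP⟩

theorem realize_term (h : τ.IsInner e) {α : Type} (t : L₁.Term α) (v : α → N) (b : N) :
    (τ.term t).Realize (Sum.elim (fun p => e (v p.1) p.2) (e b)) ↔ b = t.realize v := by
  induction t generalizing b with
  | var x =>
    simp only [term, Formula.realize_iInf, Formula.realize_equal, Term.realize_var, Sum.elim_inl,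
      Sum.elim_inr]
    exact ⟨fun H => h.injective (funext H), fun H i => by rw [H]⟩
  | @func n f ts ih =>
    simp only [term, Formula.realize_iExs, Formula.realize_inf, Formula.realize_iInf,
      Formula.realize_relabel, and_assoc]
    refine (h.exists_tuple (fun w => (∀ j, (τ.term (ts j)).Realize
      (Sum.elim (Sum.elim (fun p : α × Fin τ.dim => e (v p.1) p.2) (e b)) w ∘
        Sum.elim (fun p => Sum.inl (Sum.inl p)) (fun i => Sum.inr (j, i)))) ∧
      (τ.fn f).Realize (Sum.elim (Sum.elim (fun p : α × Fin τ.dim => e (v p.1) p.2) (e b)) w ∘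
        Sum.elim (fun p => Sum.inr p) (fun i => Sum.inl (Sum.inr i))))).trans ?_
    have h₁ : ∀ (a : Fin n → N) (j : Fin n),
        (Sum.elim (Sum.elim (fun p : α × Fin τ.dim => e (v p.1) p.2) (e b))
          (fun p : Fin n × Fin τ.dim => e (a p.1) p.2) ∘
        Sum.elim (fun p => Sum.inl (Sum.inl p)) (fun i => Sum.inr (j, i))) =
          Sum.elim (fun p => e (v p.1) p.2) (e (a j)) := by
      intro a j
      funext p
      rcases p with p | p <;> rfl
    have h₂ : ∀ a : Fin n → N,
        (Sum.elim (Sum.elim (fun p : α × Fin τ.dim => e (v p.1) p.2) (e b))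
          (fun p : Fin n × Fin τ.dim => e (a p.1) p.2) ∘
        Sum.elim (fun p => Sum.inr p) (fun i => Sum.inl (Sum.inr i))) =
          Sum.elim (fun p => e (a p.1) p.2) (e b) := by
      intro a
      funext p
      rcases p with p | p <;> rfl
    simp only [h₁, h₂, ih, h.realize_fn, Term.realize_func]
    constructor
    · rintro ⟨a, ha, rfl⟩
      congr 1
      exact funext ha
    · rintro rfl
      exact ⟨_, fun _ => rfl, rfl⟩

theorem realize_atomic (h : τ.IsInner e) {α : Type} {n : ℕ}
    (ψ : L₂.Formula (Fin n × Fin τ.dim)) (ts : Fin n → L₁.Term α) (v : α → N) :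
    (τ.atomic ψ ts).Realize (fun p => e (v p.1) p.2) ↔
      ψ.Realize (fun p => e ((ts p.1).realize v) p.2) := by
  simp only [atomic, Formula.realize_iExs, Formula.realize_inf, Formula.realize_iInf,
    Formula.realize_relabel, and_assoc]
  refine (h.exists_tuple (fun w => (∀ j, (τ.term (ts j)).Realize
    (Sum.elim (fun p : α × Fin τ.dim => e (v p.1) p.2) w ∘
      Sum.elim Sum.inl (fun i => Sum.inr (j, i)))) ∧
    ψ.Realize (Sum.elim (fun p : α × Fin τ.dim => e (v p.1) p.2) w ∘ Sum.inr))).trans ?_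
  have h₁ : ∀ (a : Fin n → N) (j : Fin n),
      (Sum.elim (fun p : α × Fin τ.dim => e (v p.1) p.2)
        (fun p : Fin n × Fin τ.dim => e (a p.1) p.2) ∘
      Sum.elim Sum.inl (fun i => Sum.inr (j, i))) =
        Sum.elim (fun p => e (v p.1) p.2) (e (a j)) := by
    intro a j
    funext p
    rcases p with p | p <;> rfl
  simp only [h₁, Sum.elim_comp_inr, h.realize_term]
  constructor
  · rintro ⟨a, ha, H⟩
    rwa [funext ha] at H
  · intro H
    exact ⟨_, fun _ => rfl, H⟩

theorem realize_formula (h : τ.IsInner e) {α : Type} {n : ℕ} (φ : L₁.BoundedFormula α n)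
    (v : α → N) (xs : Fin n → N) :
    (τ.formula φ).Realize (fun p => e (Sum.elim v xs p.1) p.2) ↔ φ.Realize v xs := by
  induction φ with
  | falsum => exact Iff.rfl
  | equal t₁ t₂ =>
    refine (h.realize_atomic _ _ _).trans ((h.realize_eq
      (fun j => (![t₁, t₂] j).realize (Sum.elim v xs))).trans ?_)
    exact Iff.rfl
  | rel R ts =>
    exact (h.realize_atomic _ _ _).trans ((h.realize_rel R fun j => (ts j).realize (Sum.elim v xs)).trans
      BoundedFormula.realize_rel.symm)
  | imp φ ψ ihφ ihψ =>
    simp only [formula, Formula.realize_imp, BoundedFormula.realize_imp, ihφ, ihψ]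
  | @all n φ ih =>
    simp only [formula, Formula.realize_iAlls, Formula.realize_imp, Formula.realize_relabel,
      BoundedFormula.realize_all]
    change (∀ w : Fin τ.dim → M, τ.dom.Realize w → _) ↔ _
    -- `splitLast` sends the tuple of the last bound variable to the quantified block, so the block
    -- is `e b` exactly when `b` is appended to the assignment.
    have key : ∀ b : N,
        ((fun a => Sum.elim (fun p : (α ⊕ Fin n) × Fin τ.dim => e (Sum.elim v xs p.1) p.2) (e b) a)
          ∘ splitLast) = fun p => e (Sum.elim v (Fin.snoc xs b) p.1) p.2 := by
      intro b
      funext p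
      obtain ⟨p | k, i⟩ := p
      · rfl
      · induction k using Fin.lastCases <;> simp [splitLast]
    constructor
    · intro H b
      rw [← ih, ← key]
      exact H (e b) ((h.realize_dom _).2 ⟨b, rfl⟩)
    · intro H w hw
      obtain ⟨b, rfl⟩ := (h.realize_dom _).1 hw
      rw [key, ih]
      exact H b

theorem realize_sentence (h : τ.IsInner e) (φ : L₁.Sentence) (v : (Empty ⊕ Fin 0) × Fin τ.dim → M) :
    (τ.formula φ).Realize v ↔ N ⊨ φ := by
  have : v = fun p => e (Sum.elim (default : Empty → N) (default : Fin 0 → N) p.1) p.2 := by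
    funext p
    exact p.1.elim (fun x => x.elim) (fun x => x.elim0)
  rw [this, h.realize_formula]
  exact Iff.rfl

end IsInner

theorem realize_equalityAxiom {L : FirstOrder.Language.{0, 0}} {N : Type} [L.Structure N]
    {φ : L.Sentence} (h : EqualityAxiom L φ) : N ⊨ φ := by
  cases h with
  | refl => simp [Sentence.Realize, Formula.Realize]
  | symm => simp [Sentence.Realize, Formula.Realize, Fin.snoc, eq_comm]
  | trans =>
    simp [Sentence.Realize, Formula.Realize, Fin.snoc]
  | congrFn f =>
    simp only [Sentence.Realize, Formula.realize_iAlls, Formula.realize_imp, Formula.realize_iInf,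
      Formula.realize_equal, Term.realize_var, Term.realize_func, Sum.elim_inr]
    intro w hw
    exact congrArg _ (funext hw)
  | congrRel R =>
    simp only [Sentence.Realize, Formula.realize_iAlls, Formula.realize_imp, Formula.realize_iInf,
      Formula.realize_equal, Term.realize_var, Formula.realize_rel, Sum.elim_inr]
    intro w hw H
    rwa [← funext hw]

/-- A translation that defines a model of `S` in every model of `T` is an interpretation. -/
theorem isInterpretation_of_isInner (τ : RelTranslation L₁ L₂) {S : L₁.Theory} {T : L₂.Theory}
    (H : ∀ (M : Type) [L₂.Structure M] [M ⊨ T], ∃ (N : Type) (_ : L₁.Structure N)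
      (e : N → Fin τ.dim → M), Nonempty N ∧ N ⊨ S ∧ τ.IsInner e) :
    τ.IsInterpretation S T where
  dom_nonempty := by
    rw [Theory.models_formula_iff]
    intro M v
    obtain ⟨N, _, e, ⟨a⟩, -, h⟩ := H M
    rw [Formula.realize_iExs]
    exact ⟨e a, Formula.realize_relabel.2 ((h.realize_dom _).2 ⟨a, rfl⟩)⟩
  fn_total := by
    intro n f
    rw [Theory.models_formula_iff]
    intro M v
    obtain ⟨N, _, e, -, -, h⟩ := H M
    simp only [Formula.realize_imp, Formula.realize_iInf, Formula.realize_relabel,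
      Formula.realize_iExsUnique, Formula.realize_inf]
    intro hv
    choose a ha using fun j => (h.realize_dom _).1 (hv j)
    have hv' : v = fun p => e (a p.1) p.2 := by
      funext p
      exact (congrFun (ha p.1) p.2).symm
    subst hv'
    refine ⟨e (Structure.funMap f a), ⟨(h.realize_dom _).2 ⟨_, rfl⟩, (h.realize_fn f a _).2 rfl⟩, ?_⟩
    rintro w ⟨hw, hw'⟩
    change τ.dom.Realize w at hw
    obtain ⟨b, rfl⟩ := (h.realize_dom _).1 hw
    exact congrArg e ((h.realize_fn f a b).1 hw')
  eq_axioms := by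
    intro φ hφ
    rw [Theory.models_formula_iff]
    intro M v
    obtain ⟨N, _, e, -, -, h⟩ := H M
    exact (h.realize_sentence φ v).2 (realize_equalityAxiom hφ)
  axioms := by
    intro φ hφ
    rw [Theory.models_formula_iff]
    intro M v
    obtain ⟨N, _, e, -, hS, h⟩ := H M
    exact (h.realize_sentence φ v).2 (hS.realize_of_mem φ hφ)

end RelTranslation

/-! ### Right cancellative semigroups with two letters -/

/-- A binary operation with two distinguished elements `0` and `1`. -/
class BitMagma (M : Type) extends Mul M where
  /-- the element `0` (for `false`) or `1` (for `true`) -/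
  bit : Bool → M

/-- The universal axioms shared by `ID` and `ID*`. -/
class BitSemigroup (M : Type) [BitMagma M] : Prop where
  assoc : ∀ x y z : M, x * y * z = x * (y * z)
  cancel : ∀ (x y : M) (c : Bool), x * BitMagma.bit c = y * BitMagma.bit c → x = y
  ne : ∀ x y : M, x * BitMagma.bit false ≠ y * BitMagma.bit true

namespace BitSemigroup

open BitMagma

variable {M : Type} [BitMagma M]

/-- The value of the biteral of a nonempty string. -/
def val : List Bool → M
  | [] => bit false
  | a :: l => l.foldl (fun x c => x * bit c) (bit a)

theorem val_concat {l : List Bool} (hl : l ≠ []) (c : Bool) :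
    (val (l ++ [c]) : M) = val l * bit c := by
  cases l with
  | nil => exact absurd rfl hl
  | cons a l => simp [val]

/-- Induction on nonempty strings by appending letters. -/
@[elab_as_elim]
theorem string_induction {P : ∀ l : List Bool, l ≠ [] → Prop}
    (single : ∀ c, P [c] (List.cons_ne_nil _ _))
    (concat : ∀ l c (hl : l ≠ []), P l hl → P (l ++ [c]) (by simp)) (l : List Bool)
    (hl : l ≠ []) : P l hl := by
  induction l using List.reverseRecOn with
  | nil => exact absurd rfl hl
  | append_singleton l c ih =>
    rcases eq_or_ne l [] with rfl | h
    · exact single c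
    · exact concat l c h (ih h)

/-- `e` is a right identity. -/
def IsRightId (e : M) : Prop := ∀ y : M, y * e = y

variable (M) in
/-- `x` is the value of a biteral. -/
def IsStd (x : M) : Prop := ∃ l : List Bool, l ≠ [] ∧ x = val l

theorem isStd_bit (c : Bool) : IsStd M (bit c) := ⟨[c], by simp, rfl⟩

theorem IsStd.eq_bit_or {x : M} (h : IsStd M x) :
    (∃ c, x = bit c) ∨ ∃ y c, IsStd M y ∧ x = y * bit c := by
  obtain ⟨l, hl, rfl⟩ := h
  induction l, hl using string_induction with
  | single c => exact Or.inl ⟨c, rfl⟩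
  | concat l c h _ => exact Or.inr ⟨val l, c, ⟨l, h, rfl⟩, val_concat h c⟩

/-- `x` is a factor of `y`, possibly the whole of it. -/
def IsFactor (x y : M) : Prop :=
  x = y ∨ ∃ u v : M, (y = u * x ∨ y = x * v) ∨ y = u * x * v

/-! ### The domain of the interpretation of `ID*` in `ID` -/

section Domain

/-- Below the values of biterals, `le` is the prefix relation. -/
def IsPrefixOnStd (le : M → M → Prop) : Prop :=
  ∀ l : List Bool, l ≠ [] → ∀ x : M, le x (val l) ↔ ∃ l', (l' ≠ [] ∧ l' <+: l) ∧ x = val l'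

variable (le : M → M → Prop)

/-- `x ⪯ g`, or `x` plays the role of the empty string. -/
def WeakLe (x g : M) : Prop := le x g ∨ IsRightId x

/-- The set of all `x ⪯ g` is closed under removing the last letter. -/
def PredClosed (g : M) : Prop := ∀ x c, le (x * bit c) g → WeakLe le x g

/-- Cancelling `v` on the right does not lead out of the sets `{x | x ⪯ g}`. -/
def Removable (v : M) : Prop :=
  ∀ g, PredClosed le g → ∀ x, WeakLe le (x * v) g → WeakLe le x g

/-- `x` is obtained from a letter by appending letters, as far as `⪯` can tell. -/
def StringLike (x : M) : Prop :=
  Removable le x ∧ le x x ∧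
    ∀ y, le y x → (∃ c, y = bit c) ∨ ∃ z c, le z x ∧ y = z * bit c

/-- Products of string-like elements that occur in some `x ⪯ g` are string-like. -/
def MulClosed (g : M) : Prop :=
  PredClosed le g ∧ ∀ u x y, StringLike le x → StringLike le y →
    le (u * (x * y)) g → StringLike le (x * y)

/-- `v` does not occur in any `x ⪯ g`, for suitable `g`. -/
def Remote (v : M) : Prop :=
  Removable le v ∧ ∀ g, MulClosed le g → ∀ u, ¬ WeakLe le (u * v) g

/-- The domain of the interpretation. -/
def InDomain (v : M) : Prop := StringLike le v ∨ Remote le v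

variable {le : M → M → Prop}

theorem InDomain.removable {x : M} (h : InDomain le x) : Removable le x := h.elim And.left And.left

theorem isStd_of_weakLe (hle : IsPrefixOnStd le) {l : List Bool} (hl : l ≠ []) {x : M} (h : WeakLe le x (val l)) :
    IsStd M x ∨ IsRightId x := by
  refine h.imp_left fun h => ?_
  obtain ⟨l', ⟨h₁, -⟩, h₂⟩ := (hle l hl x).1 h
  exact ⟨l', h₁, h₂⟩

theorem le_val_self (hle : IsPrefixOnStd le) {l : List Bool} (hl : l ≠ []) : le (val l : M) (val l) :=
  (hle l hl _).2 ⟨l, ⟨hl, List.prefix_rfl⟩, rfl⟩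

end Domain

/-! ### Consequences of the axioms -/

variable [BitSemigroup M]

theorem eq_of_mul_bit_eq {x y : M} {c d : Bool} (h : x * bit c = y * bit d) : c = d ∧ x = y := by
  cases c <;> cases d
  · exact ⟨rfl, cancel _ _ _ h⟩
  · exact absurd h (ne _ _)
  · exact absurd h.symm (ne _ _)
  · exact ⟨rfl, cancel _ _ _ h⟩

theorem not_isRightId_bit (c : Bool) : ¬ IsRightId (bit c : M) := by
  intro h
  -- A right identity `bit c` would give this product both last letters. The letter is doubled
  -- because the axioms compare last letters of products only.
  have h₁ : (bit (!c) : M) * bit (!c) * bit c = bit (!c) * bit (!c) := h _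
  have := (eq_of_mul_bit_eq h₁).1
  cases c <;> simp at this

/-- Multiplying by an arbitrary `y` on the left turns the single letter into a product, to which
right cancellation applies. -/
theorem isRightId_of_mul_bit_eq_bit {x : M} {c d : Bool} (h : x * bit c = bit d) :
    c = d ∧ IsRightId x := by
  have key : ∀ y : M, y * x * bit c = y * bit d := fun y => by rw [assoc, h]
  exact ⟨(eq_of_mul_bit_eq (key x)).1, fun y => (eq_of_mul_bit_eq (key y)).2⟩

theorem not_isRightId_mul_bit (x : M) (c : Bool) : ¬ IsRightId (x * bit c) := by
  intro h
  have h₁ : (bit (!c) : M) * bit (!c) * x * bit c = bit (!c) * bit (!c) := by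
    rw [assoc (bit (!c) * bit (!c))]
    exact h _
  have := (eq_of_mul_bit_eq h₁).1
  cases c <;> simp at this

theorem IsStd.not_isRightId {x : M} (h : IsStd M x) : ¬ IsRightId x := by
  obtain ⟨c, rfl⟩ | ⟨y, c, -, rfl⟩ := h.eq_bit_or
  · exact not_isRightId_bit c
  · exact not_isRightId_mul_bit y c

theorem val_append {l l' : List Bool} (hl : l ≠ []) (hl' : l' ≠ []) :
    (val (l ++ l') : M) = val l * val l' := by
  induction l', hl' using string_induction with
  | single c => exact val_concat hl c
  | concat l' c h ih => rw [← List.append_assoc, val_concat (by simp [hl]), val_concat h, ih, assoc]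

theorem val_injective {l l' : List Bool} (hl : l ≠ []) (hl' : l' ≠ [])
    (h : (val l : M) = val l') : l = l' := by
  induction l, hl using string_induction generalizing l' with
  | single c =>
    induction l', hl' using string_induction with
    | single d =>
      -- Single letters are told apart only after a factor is put in front of them.
      have : (bit c : M) * bit c = bit c * bit d := congrArg (bit c * ·) h
      rw [(eq_of_mul_bit_eq this).1]
    | concat l' d h' _ =>
      rw [val_concat h'] at h
      exact absurd (isRightId_of_mul_bit_eq_bit h.symm).2 (IsStd.not_isRightId ⟨l', h', rfl⟩)
  | concat l c hl ih =>
    rw [val_concat hl] at h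
    induction l', hl' using string_induction with
    | single d => exact absurd (isRightId_of_mul_bit_eq_bit h).2 (IsStd.not_isRightId ⟨l, hl, rfl⟩)
    | concat l' d h' _ =>
      rw [val_concat h'] at h
      obtain ⟨rfl, h₂⟩ := eq_of_mul_bit_eq h
      rw [ih h' h₂]

theorem IsStd.mul {x y : M} (hx : IsStd M x) (hy : IsStd M y) : IsStd M (x * y) := by
  obtain ⟨l, hl, rfl⟩ := hx
  obtain ⟨l', hl', rfl⟩ := hy
  exact ⟨l ++ l', by simp [hl], (val_append hl hl').symm⟩

/-! ### Closure properties of the domain and its behaviour below biterals -/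

variable {le : M → M → Prop}

theorem Removable.mul {x y : M} (hx : Removable le x) (hy : Removable le y) :
    Removable le (x * y) := by
  intro g hg z hz
  rw [← assoc] at hz
  exact hx g hg _ (hy g hg _ hz)

theorem removable_bit (c : Bool) : Removable le (bit c : M) := by
  intro g hg x hx
  rcases hx with hx | hx
  · exact hg x c hx
  · exact absurd hx (not_isRightId_mul_bit x c)

/-- Since `x ⪯ x`, the last clause of `StringLike` applies to `x` itself: `x` is a letter or ends in
one, and so `u * x` ends in a letter. -/
theorem StringLike.not_isRightId_mul {x : M} (hx : StringLike le x) (u : M) :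
    ¬ IsRightId (u * x) := by
  obtain ⟨c, rfl⟩ | ⟨z, c, -, h⟩ := hx.2.2 x hx.2.1
  · exact not_isRightId_mul_bit u c
  · rw [h, ← assoc]
    exact not_isRightId_mul_bit _ c

theorem StringLike.not_isRightId {x : M} (hx : StringLike le x) : ¬ IsRightId x := by
  obtain ⟨c, h⟩ | ⟨z, c, -, h⟩ := hx.2.2 x hx.2.1
  · rw [h]
    exact not_isRightId_bit c
  · rw [h]
    exact not_isRightId_mul_bit z c

theorem isStd_removable {x : M} (hx : IsStd M x) : Removable le x := by
  obtain ⟨l, hl, rfl⟩ := hx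
  induction l, hl using string_induction with
  | single c => exact removable_bit c
  | concat l c h ih =>
    rw [val_concat h]
    exact ih.mul (removable_bit c)

/-- A string-like right factor of a biteral is a biteral. -/
theorem StringLike.isStd_of_mul {x u : M} (hx : StringLike le x) (h : IsStd M (u * x)) :
    IsStd M x := by
  -- The induction strips letters from `x`, and the results are only known to stay `⪯ x`; hence the
  -- generalization to all such `y`.
  suffices H : ∀ l : List Bool, l ≠ [] → ∀ y, le y x → u * y = val l → IsStd M y by
    obtain ⟨l, hl, h⟩ := h
    exact H l hl x hx.2.1 h
  intro l hl
  induction l, hl using string_induction with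
  | single d =>
    intro y hy h
    obtain ⟨c, rfl⟩ | ⟨z, c, hz, rfl⟩ := hx.2.2 y hy
    · exact isStd_bit c
    · rw [← assoc] at h
      -- Here `u * z` would be a right identity, but `z` is a letter or ends in one.
      have hr := (isRightId_of_mul_bit_eq_bit h).2
      obtain ⟨c', rfl⟩ | ⟨z', c', -, rfl⟩ := hx.2.2 z hz
      · exact absurd hr (not_isRightId_mul_bit u c')
      · rw [← assoc] at hr
        exact absurd hr (not_isRightId_mul_bit _ c')
  | concat l d hl ih =>
    intro y hy h
    obtain ⟨c, rfl⟩ | ⟨z, c, hz, rfl⟩ := hx.2.2 y hy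
    · exact isStd_bit c
    · rw [val_concat hl, ← assoc] at h
      obtain ⟨rfl, h₂⟩ := eq_of_mul_bit_eq h
      exact (ih z hz h₂).mul (isStd_bit c)

/-- If `x * y` is not remote, then `u * (x * y)` is weakly below some `MulClosed` `g`. A remote `y`
forbids this at once; a remote `x` forbids it after the removable `y` is cancelled; if both are
string-like, `MulClosed` makes the product string-like. -/
theorem InDomain.mul {x y : M} (hx : InDomain le x) (hy : InDomain le y) :
    InDomain le (x * y) := by
  by_contra hxy
  simp only [InDomain, Remote, not_or, not_and, not_forall, not_not] at hxy
  obtain ⟨hA, hB⟩ := hxy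
  obtain ⟨g, hg, u, hu⟩ := hB (hx.removable.mul hy.removable)
  rcases hy with hy | hy
  · rcases hx with hx | hx
    · rcases hu with hu | hu
      · exact hA (hg.2 u x y hx hy hu)
      · rw [← assoc] at hu
        exact hy.not_isRightId_mul _ hu
    · rw [← assoc] at hu
      exact hx.2 g hg u (hy.1 g hg.1 _ hu)
  · rw [← assoc] at hu
    exact hy.2 g hg _ hu

theorem predClosed_val (hle : IsPrefixOnStd le) {l : List Bool} (hl : l ≠ []) : PredClosed le (val l : M) := by
  intro x c hx
  obtain ⟨l', ⟨h₁, h₂⟩, h⟩ := (hle l hl _).1 hx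
  induction l', h₁ using string_induction with
  | single d => exact Or.inr (isRightId_of_mul_bit_eq_bit h).2
  | concat l' d h' _ =>
    rw [val_concat h'] at h
    obtain ⟨-, rfl⟩ := eq_of_mul_bit_eq h
    exact Or.inl ((hle l hl _).2 ⟨l', ⟨h', (List.prefix_append _ _).trans h₂⟩, rfl⟩)

theorem isStd_stringLike (hle : IsPrefixOnStd le) {x : M} (hx : IsStd M x) : StringLike le x := by
  refine ⟨isStd_removable hx, ?_⟩
  obtain ⟨l, hl, rfl⟩ := hx
  refine ⟨(hle l hl _).2 ⟨l, ⟨hl, List.prefix_rfl⟩, rfl⟩, fun y hy => ?_⟩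
  obtain ⟨l', ⟨h₁, h₂⟩, rfl⟩ := (hle l hl _).1 hy
  induction l', h₁ using string_induction with
  | single d => exact Or.inl ⟨d, rfl⟩
  | concat l' d h' _ =>
    exact Or.inr ⟨val l', d, (hle l hl _).2 ⟨l', ⟨h', (List.prefix_append _ _).trans h₂⟩, rfl⟩,
      val_concat h' d⟩

theorem isStd_inDomain (hle : IsPrefixOnStd le) {x : M} (hx : IsStd M x) : InDomain le x :=
  Or.inl (isStd_stringLike hle hx)

/-- If `u * x * y` is a biteral, the string-like `y` is one. Cancelling `y` leaves `u * x` a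
biteral, as it ends in a letter and is no right identity; so `x` is a biteral too, and products of
biterals are string-like. -/
theorem mulClosed_val (hle : IsPrefixOnStd le) {l : List Bool} (hl : l ≠ []) : MulClosed le (val l : M) := by
  refine ⟨predClosed_val hle hl, fun u x y hx hy h => ?_⟩
  rw [← assoc] at h
  have hy' : IsStd M y := by
    obtain ⟨l', ⟨h₁, -⟩, h₂⟩ := (hle l hl _).1 h
    exact hy.isStd_of_mul ⟨l', h₁, h₂⟩
  have hx' : IsStd M x := by
    obtain h | h := isStd_of_weakLe hle hl (hy.1 _ (predClosed_val hle hl) _ (Or.inl h))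
    · exact hx.isStd_of_mul h
    · exact absurd h (hx.not_isRightId_mul u)
  exact isStd_stringLike hle (hx'.mul hy')

theorem InDomain.not_isRightId (hle : IsPrefixOnStd le) {x : M} (hx : InDomain le x) : ¬ IsRightId x := by
  intro h
  rcases hx with hx | hx
  · exact hx.not_isRightId h
  · refine hx.2 (val [false]) (mulClosed_val hle (by simp)) (val [false]) ?_
    rw [h]
    exact Or.inl (le_val_self hle (by simp))

/-- The factors of a biteral in the domain are biterals. -/
theorem InDomain.isStd_of_mul (hle : IsPrefixOnStd le) {x y : M} (hx : InDomain le x) (hy : InDomain le y)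
    (h : IsStd M (x * y)) : IsStd M x ∧ IsStd M y := by
  obtain ⟨l, hl, hxy⟩ := h
  have hw : WeakLe le (x * y) (val l) := by
    rw [hxy]
    exact Or.inl (le_val_self hle hl)
  constructor
  · obtain h | h := isStd_of_weakLe hle hl (hy.removable _ (predClosed_val hle hl) _ hw)
    · exact h
    · exact absurd h (hx.not_isRightId hle)
  · rcases hy with hy | hy
    · exact hy.isStd_of_mul ⟨l, hl, hxy⟩
    · exact absurd hw (hy.2 _ (mulClosed_val hle hl) x)

/-! ### Factors of biterals -/

theorem exists_infix_of_isFactor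
    (H : ∀ x y : M, IsStd M (x * y) → IsStd M x ∧ IsStd M y) {l : List Bool} (hl : l ≠ []) {x : M}
    (hx : IsFactor x (val l)) : ∃ l', (l' ≠ [] ∧ l' <:+: l) ∧ x = val l' := by
  have hs : IsStd M (val l) := ⟨l, hl, rfl⟩
  rcases hx with rfl | ⟨u, v, (h | h) | h⟩
  · exact ⟨l, ⟨hl, List.infix_rfl⟩, rfl⟩
  · obtain ⟨⟨a, ha, rfl⟩, ⟨b, hb, rfl⟩⟩ := H u x (h ▸ hs)
    rw [← val_append ha hb] at h
    rw [val_injective hl (by simp [ha]) h]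
    exact ⟨b, ⟨hb, List.infix_append a b [] |>.trans (by simp)⟩, rfl⟩
  · obtain ⟨⟨a, ha, rfl⟩, ⟨b, hb, rfl⟩⟩ := H x v (h ▸ hs)
    rw [← val_append ha hb] at h
    rw [val_injective hl (by simp [ha]) h]
    exact ⟨a, ⟨ha, List.infix_append [] a b⟩, rfl⟩
  · obtain ⟨h₁, ⟨b, hb, rfl⟩⟩ := H (u * x) v (h ▸ hs)
    obtain ⟨⟨a, ha, rfl⟩, ⟨d, hd, rfl⟩⟩ := H u x h₁
    rw [← val_append ha hd, ← val_append (by simp [ha]) hb] at h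
    rw [val_injective hl (by simp [ha]) h]
    exact ⟨d, ⟨hd, List.infix_append a d b⟩, rfl⟩

/-- If all factors of biterals are biterals, then the left factors of a biteral are the biterals of
its prefixes. -/
theorem left_factor_iff_prefix
    (H : ∀ l : List Bool, l ≠ [] → ∀ x : M, IsFactor x (val l) →
      ∃ l', (l' ≠ [] ∧ l' <:+: l) ∧ x = val l')
    {l : List Bool} (hl : l ≠ []) (x : M) :
    (x = val l ∨ ∃ v, val l = x * v) ↔ ∃ l', (l' ≠ [] ∧ l' <+: l) ∧ x = val l' := by
  constructor
  · rintro (rfl | ⟨v, h⟩)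
    · exact ⟨l, ⟨hl, List.prefix_rfl⟩, rfl⟩
    · obtain ⟨a, ⟨ha, -⟩, rfl⟩ := H l hl x (Or.inr ⟨x, v, Or.inl (Or.inr h)⟩)
      obtain ⟨b, ⟨hb, -⟩, rfl⟩ := H l hl v (Or.inr ⟨_, v, Or.inl (Or.inl h)⟩)
      rw [← val_append ha hb] at h
      rw [val_injective hl (by simp [ha]) h]
      exact ⟨a, ⟨ha, List.prefix_append a b⟩, rfl⟩
  · rintro ⟨a, ⟨ha, ⟨b, rfl⟩⟩, rfl⟩
    rcases eq_or_ne b [] with rfl | hb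
    · exact Or.inl (by simp)
    · exact Or.inr ⟨val b, val_append ha hb⟩

end BitSemigroup

/-! ### Formulas with named variables -/

namespace NamedFormula

variable {L : FirstOrder.Language.{0, 0}} {M : Type} [L.Structure M]

/-- The formula `∀ xₖ φ`. -/
noncomputable def all (k : ℕ) (φ : L.Formula ℕ) : L.Formula ℕ :=
  Formula.iAlls Unit (φ.relabel fun i => if i = k then Sum.inr () else Sum.inl i)

/-- The formula `∃ xₖ φ`. -/
noncomputable def ex (k : ℕ) (φ : L.Formula ℕ) : L.Formula ℕ := (all k φ.not).not

@[simp]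
theorem realize_all {k : ℕ} {φ : L.Formula ℕ} {v : ℕ → M} :
    (all k φ).Realize v ↔ ∀ a, φ.Realize (Function.update v k a) := by
  have key : ∀ w : Unit → M, ((fun a => Sum.elim v w a) ∘
      fun i : ℕ => if i = k then Sum.inr () else Sum.inl i) = Function.update v k (w ()) := by
    intro w
    funext i
    by_cases h : i = k <;> simp [h]
  simp only [all, Formula.realize_iAlls, Formula.realize_relabel, key]
  exact ⟨fun H a => H fun _ => a, fun H w => H (w ())⟩

@[simp]
theorem realize_ex {k : ℕ} {φ : L.Formula ℕ} {v : ℕ → M} :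
    (ex k φ).Realize v ↔ ∃ a, φ.Realize (Function.update v k a) := by
  simp [ex, Formula.realize_not]

end NamedFormula

/-! ### Structures for languages of concatenation -/

namespace Concat

open BitSemigroup

/-- The function symbols are interpreted by the operations of the `BitMagma`. -/
class IsCompatible (R : ℕ → Type) (M : Type) [(concatLang R).Structure M] [BitMagma M] : Prop where
  funMap_zero : ∀ v : Fin 0 → M, Structure.funMap (L := concatLang R) ConcatFn.zero v = BitMagma.bit false
  funMap_one : ∀ v : Fin 0 → M, Structure.funMap (L := concatLang R) ConcatFn.one v = BitMagma.bit true
  funMap_conc : ∀ v : Fin 2 → M,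
    Structure.funMap (L := concatLang R) ConcatFn.conc v = v 0 * v 1

/-- The operations of a structure. -/
abbrev toBitMagma (R : ℕ → Type) (M : Type) [(concatLang R).Structure M] : BitMagma M where
  mul x y := Structure.funMap (L := concatLang R) ConcatFn.conc ![x, y]
  bit
    | false => Structure.funMap (L := concatLang R) ConcatFn.zero default
    | true => Structure.funMap (L := concatLang R) ConcatFn.one default

theorem isCompatible_toBitMagma (R : ℕ → Type) (M : Type) [(concatLang R).Structure M] :
    @IsCompatible R M _ (toBitMagma R M) := by
  let := toBitMagma R M
  refine ⟨fun v => ?_, fun v => ?_, fun v => ?_⟩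
  · rw [Subsingleton.elim v default]
    rfl
  · rw [Subsingleton.elim v default]
    rfl
  · have : v = ![v 0, v 1] := by
      funext i
      fin_cases i <;> rfl
    rw [this]
    rfl

/-- The structure given by a `BitMagma` and an interpretation of the relation symbols. -/
abbrev toStructure {R : ℕ → Type} {N : Type} [BitMagma N]
    (r : ∀ {n}, R n → (Fin n → N) → Prop) : (concatLang R).Structure N where
  funMap
    | ConcatFn.zero => fun _ => BitMagma.bit false
    | ConcatFn.one => fun _ => BitMagma.bit true
    | ConcatFn.conc => fun v => v 0 * v 1
  RelMap := r

theorem isCompatible_toStructure {R : ℕ → Type} {N : Type} [BitMagma N]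
    (r : ∀ {n}, R n → (Fin n → N) → Prop) : @IsCompatible R N (toStructure r) _ :=
  @IsCompatible.mk R N (toStructure r) _ (fun _ => rfl) (fun _ => rfl) (fun _ => rfl)

variable {R : ℕ → Type} {M : Type} [(concatLang R).Structure M] [BitMagma M] [IsCompatible R M]

section

variable {β : Type}

@[simp]
theorem realize_bit (c : Bool) (v : β → M) :
    (bit c : (concatLang R).Term β).realize v = BitMagma.bit c := by
  cases c
  · exact IsCompatible.funMap_zero _
  · exact IsCompatible.funMap_one _

@[simp]
theorem realize_conc (s t : (concatLang R).Term β) (v : β → M) :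
    (conc s t).realize v = s.realize v * t.realize v :=
  IsCompatible.funMap_conc _

theorem realize_foldl_conc (l : List Bool) (t : (concatLang R).Term β) (v : β → M) :
    (l.foldl (fun t b => conc t (bit b)) t).realize v =
      l.foldl (fun x c => x * BitMagma.bit c) (t.realize v) := by
  induction l generalizing t with
  | nil => rfl
  | cons a l ih => simp [ih]

@[simp]
theorem realize_biteral (l : List Bool) (v : β → M) :
    (biteral l : (concatLang R).Term β).realize v = val l := by
  cases l with
  | nil => exact realize_bit (R := R) false v
  | cons a l => simp [biteral, val, realize_foldl_conc]

end

theorem realize_ax1 : M ⊨ (ax1 : (concatLang R).Sentence) ↔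
    ∀ x y z : M, x * y * z = x * (y * z) := by
  simp [ax1, Sentence.Realize, Formula.Realize, Fin.snoc]

theorem realize_ax2 : M ⊨ (ax2 : (concatLang R).Sentence) ↔
    ∀ (x y : M) (c : Bool), x * BitMagma.bit c = y * BitMagma.bit c → x = y := by
  simp only [Bool.forall_bool]
  simp [ax2, Sentence.Realize, Formula.Realize, Fin.snoc]
  grind

theorem realize_ax3 : M ⊨ (ax3 : (concatLang R).Sentence) ↔
    ∀ x y : M, x * BitMagma.bit false ≠ y * BitMagma.bit true := by
  simp [ax3, Sentence.Realize, Formula.Realize, Fin.snoc]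

theorem realize_iSup_eq_biteral (S : Set (List Bool)) [Finite S] {n : ℕ} (v : Empty → M)
    (xs : Fin (n + 1) → M) :
    (BoundedFormula.iSup fun γ : S =>
      ((&0 : (concatLang R).Term (Empty ⊕ Fin (n + 1))) =' biteral γ.1)).Realize v xs ↔
      ∃ γ ∈ S, xs 0 = val γ := by
  simp

theorem realize_ax4 {M : Type} [LBT.Structure M] [BitMagma M] [IsCompatible PrefixRel M]
    (l : List Bool) : M ⊨ ax4 l ↔
      ∀ x : M, Structure.RelMap (L := LBT) PrefixRel.prec ![x, val l] ↔
        ∃ l', (l' ≠ [] ∧ l' <+: l) ∧ x = val l' := by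
  simp only [ax4, Sentence.Realize, Formula.Realize, BoundedFormula.realize_all,
    BoundedFormula.realize_iff, realize_iSup_eq_biteral]
  simp [Fin.snoc, Pref]

theorem realize_ax4Star (l : List Bool) : M ⊨ (ax4Star l : (concatLang R).Sentence) ↔
    ∀ x : M, IsFactor x (val l) → ∃ l', (l' ≠ [] ∧ l' <:+: l) ∧ x = val l' := by
  simp only [ax4Star, Sentence.Realize, Formula.Realize, BoundedFormula.realize_all,
    BoundedFormula.realize_imp, realize_iSup_eq_biteral]
  simp [substringOf, Fin.snoc, Sub, IsFactor]

theorem bitSemigroup_iff : BitSemigroup M ↔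
    M ⊨ (ax1 : (concatLang R).Sentence) ∧ M ⊨ (ax2 : (concatLang R).Sentence) ∧
      M ⊨ (ax3 : (concatLang R).Sentence) := by
  rw [realize_ax1, realize_ax2, realize_ax3]
  exact ⟨fun h => ⟨h.assoc, h.cancel, h.ne⟩, fun h => ⟨h.1, h.2.1, h.2.2⟩⟩

theorem model_IDStar_iff : M ⊨ IDStar R ↔ BitSemigroup M ∧
    ∀ l : List Bool, l ≠ [] → ∀ x : M, IsFactor x (val l) →
      ∃ l', (l' ≠ [] ∧ l' <:+: l) ∧ x = val l' := by
  simp only [← realize_ax4Star (R := R), bitSemigroup_iff (R := R), Theory.model_iff, IDStar]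
  constructor
  · intro h
    exact ⟨⟨h _ (by simp), h _ (by simp), h _ (by simp)⟩, fun l hl => h _ (Or.inr ⟨l, hl, rfl⟩)⟩
  · rintro ⟨⟨h₁, h₂, h₃⟩, h₄⟩ φ ((rfl | rfl | rfl) | ⟨l, hl, rfl⟩)
    exacts [h₁, h₂, h₃, h₄ l hl]

theorem model_ID_iff {M : Type} [LBT.Structure M] [BitMagma M] [IsCompatible PrefixRel M] :
    M ⊨ ID ↔ BitSemigroup M ∧
      IsPrefixOnStd fun x y : M => Structure.RelMap (L := LBT) PrefixRel.prec ![x, y] := by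
  simp only [IsPrefixOnStd, ← realize_ax4, bitSemigroup_iff (R := PrefixRel), Theory.model_iff, ID]
  constructor
  · intro h
    exact ⟨⟨h _ (by simp), h _ (by simp), h _ (by simp)⟩, fun l hl => h _ (Or.inr ⟨l, hl, rfl⟩)⟩
  · rintro ⟨⟨h₁, h₂, h₃⟩, h₄⟩ φ ((rfl | rfl | rfl) | ⟨l, hl, rfl⟩)
    exacts [h₁, h₂, h₃, h₄ l hl]

end Concat

/-! ### Relativizations that keep the function symbols -/

namespace Concat

open BitSemigroup

/-- The one-dimensional translation with domain `δ(x₀)` that keeps equality and the function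
symbols and replaces the relation symbols by the formulas `ρ`. -/
noncomputable def relativization {R R' : ℕ → Type} (δ : (concatLang R').Formula ℕ)
    (ρ : ∀ {n : ℕ}, R n → (concatLang R').Formula (Fin n × Fin 1)) :
    RelTranslation (concatLang R) (concatLang R') where
  dim := 1
  dim_pos := Nat.one_pos
  dom := δ.relabel fun _ => 0
  eq := Term.equal (Term.var (0, 0)) (Term.var (1, 0))
  rel := ρ
  fn f := Term.equal (Term.var (Sum.inr 0))
    (Term.func (L := concatLang R') f fun j => Term.var (Sum.inl (j, 0)))

theorem isInner_relativization {R R' : ℕ → Type} {δ : (concatLang R').Formula ℕ}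
    {ρ : ∀ {n : ℕ}, R n → (concatLang R').Formula (Fin n × Fin 1)} {M N : Type}
    [(concatLang R').Structure M] [BitMagma M] [IsCompatible R' M]
    [(concatLang R).Structure N] [BitMagma N] [IsCompatible R N]
    (i : N → M) (hi : Function.Injective i) (hmul : ∀ x y, i (x * y) = i x * i y)
    (hbit : ∀ c, i (BitMagma.bit c) = BitMagma.bit c)
    (hδ : ∀ x : M, δ.Realize (fun _ => x) ↔ ∃ a, i a = x)
    (hρ : ∀ {n : ℕ} (r : R n) (a : Fin n → N),
      (ρ r).Realize (fun p => i (a p.1)) ↔ Structure.RelMap (L := concatLang R) r a) :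
    (relativization δ ρ).IsInner (M := M) (N := N) fun a _ => i a where
  injective a b h := hi (congrFun h (0 : Fin 1))
  realize_dom w := by
    refine Formula.realize_relabel.trans ((hδ (w (0 : Fin 1))).trans (exists_congr fun a => ?_))
    refine ⟨fun h => funext fun k => ?_, fun h => congrFun h (0 : Fin 1)⟩
    rw [h, Subsingleton.elim (α := Fin 1) k 0]
  realize_eq a := Formula.realize_equal.trans hi.eq_iff
  realize_rel r a := hρ r a
  realize_fn f a b := by
    refine Formula.realize_equal.trans ?_
    change i b = Structure.funMap (L := concatLang R') f (fun j => i (a j)) ↔ _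
    rw [← hi.eq_iff]
    cases f with
    | zero => rw [IsCompatible.funMap_zero, IsCompatible.funMap_zero, hbit]
    | one => rw [IsCompatible.funMap_one, IsCompatible.funMap_one, hbit]
    | conc => rw [IsCompatible.funMap_conc, IsCompatible.funMap_conc, hmul]

/-! ### The interpretation of `ID` in `ID*` -/

/-- The formula `x₀ = x₁ ∨ ∃ v [x₁ = x₀ v]`. -/
noncomputable def leftFactorFormula (R : ℕ → Type) : (concatLang R).Formula ℕ :=
  Term.equal (Term.var 0) (Term.var 1) ⊔
    NamedFormula.ex 2 (Term.equal (Term.var 1) (conc (Term.var 0) (Term.var 2)))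

theorem interpretable_ID_IDStar (R : ℕ → Type) : Interpretable ID (IDStar R) := by
  let ρ : ∀ {n : ℕ}, PrefixRel n → (concatLang R).Formula (Fin n × Fin 1) := fun r =>
    match r with
    | .prec => (leftFactorFormula R).relabel fun k => if k = 0 then (0, 0) else (1, 0)
  refine ⟨relativization ⊤ ρ, RelTranslation.isInterpretation_of_isInner _ ?_⟩
  intro M _ hM
  let := toBitMagma R M
  have := isCompatible_toBitMagma R M
  obtain ⟨_, hstar⟩ := (model_IDStar_iff (R := R)).1 hM
  let le : M → M → Prop := fun x y => x = y ∨ ∃ v, y = x * v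
  let r : ∀ {n}, PrefixRel n → (Fin n → M) → Prop := fun q =>
    match q with
    | .prec => fun w => le (w 0) (w 1)
  let S : LBT.Structure M := toStructure r
  have hS : IsCompatible PrefixRel M := isCompatible_toStructure r
  refine ⟨M, S, fun a _ => a, ⟨BitMagma.bit false⟩, model_ID_iff.2 ⟨inferInstance, ?_⟩,
    isInner_relativization id Function.injective_id (fun _ _ => rfl) (fun _ => rfl) ?_ ?_⟩
  · intro l hl x
    exact left_factor_iff_prefix hstar hl x
  · exact fun x => ⟨fun _ => ⟨x, rfl⟩, fun _ => Formula.realize_top.2 trivial⟩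
  · rintro n ⟨⟩ a
    change Formula.Realize (Formula.relabel _ (leftFactorFormula R)) _ ↔ le (a 0) (a 1)
    simp [leftFactorFormula, le]

/-! ### The interpretation of `ID*` in `ID` -/

section DomainFormula

open NamedFormula

/-- The formula `xᵢ = xⱼ xₖ`. -/
def mulFormula (i j k : ℕ) : LBT.Formula ℕ :=
  Term.equal (Term.var i) (conc (Term.var j) (Term.var k))

/-- The formula `xᵢ ⪯ xⱼ`. -/
def leFormula (i j : ℕ) : LBT.Formula ℕ :=
  Relations.formula₂ (L := LBT) PrefixRel.prec (Term.var i) (Term.var j)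

/-- The formula defining `WeakLe`. -/
noncomputable def weakLeFormula (x g : ℕ) : LBT.Formula ℕ :=
  -- Reusing the index `x + 1` is harmless, even when `x + 1` is in use outside: only `x` is free
  -- under this quantifier.
  leFormula x g ⊔ all (x + 1) (mulFormula (x + 1) (x + 1) x)

/-- The formula defining `PredClosed`. -/
noncomputable def predClosedFormula (g : ℕ) : LBT.Formula ℕ :=
  all (g + 1) (Formula.iInf fun c : Bool =>
    (Relations.formula₂ (L := LBT) PrefixRel.prec (conc (Term.var (g + 1)) (bit c))
      (Term.var g)).imp (weakLeFormula (g + 1) g))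

/-- The formula defining `Removable`. -/
noncomputable def removableFormula (v : ℕ) : LBT.Formula ℕ :=
  all (v + 1) ((predClosedFormula (v + 1)).imp
    (all (v + 2) (all (v + 3) ((mulFormula (v + 3) (v + 2) v).imp
      ((weakLeFormula (v + 3) (v + 1)).imp (weakLeFormula (v + 2) (v + 1)))))))

/-- The formula defining `StringLike`. -/
noncomputable def stringLikeFormula (x : ℕ) : LBT.Formula ℕ :=
  removableFormula x ⊓ (leFormula x x ⊓
    all (x + 1) ((leFormula (x + 1) x).imp
      ((Formula.iSup fun c : Bool => Term.equal (Term.var (x + 1)) (bit c)) ⊔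
        ex (x + 2) (Formula.iSup fun c : Bool => leFormula (x + 2) x ⊓
          Term.equal (Term.var (x + 1)) (conc (Term.var (x + 2)) (bit c))))))

/-- The formula defining `MulClosed`. -/
noncomputable def mulClosedFormula (g : ℕ) : LBT.Formula ℕ :=
  predClosedFormula g ⊓
    -- The indices `g + 1`, `g + 2`, `g + 3` stand for `u`, `x`, `y`. The products `x * y` and `u *
    -- (x * y)` get the indices `g + 4` and `g + 5`, because the defined predicates take variables
    -- only.
    all (g + 1) (all (g + 2) (all (g + 3) ((stringLikeFormula (g + 2)).imp
      ((stringLikeFormula (g + 3)).imp (all (g + 4) ((mulFormula (g + 4) (g + 2) (g + 3)).imp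
        (all (g + 5) ((mulFormula (g + 5) (g + 1) (g + 4)).imp
          ((leFormula (g + 5) g).imp (stringLikeFormula (g + 4)))))))))))

/-- The formula defining `Remote`. -/
noncomputable def remoteFormula (v : ℕ) : LBT.Formula ℕ :=
  removableFormula v ⊓
    all (v + 1) ((mulClosedFormula (v + 1)).imp
      (all (v + 2) (all (v + 3) ((mulFormula (v + 3) (v + 2) v).imp
        (weakLeFormula (v + 3) (v + 1)).not))))

/-- The formula defining `InDomain`. -/
noncomputable def domainFormula : LBT.Formula ℕ := stringLikeFormula 0 ⊔ remoteFormula 0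

variable {M : Type} [LBT.Structure M]

variable (M) in
/-- The interpretation of the symbol `⪯`. -/
abbrev prec (x y : M) : Prop := Structure.RelMap (L := LBT) PrefixRel.prec ![x, y]

@[simp]
theorem realize_leFormula (i j : ℕ) (v : ℕ → M) :
    (leFormula i j).Realize v ↔ prec M (v i) (v j) := by
  simp [leFormula, Formula.realize_rel₂]

variable [BitMagma M] [IsCompatible PrefixRel M]

@[simp]
theorem realize_mulFormula (i j k : ℕ) (v : ℕ → M) :
    (mulFormula i j k).Realize v ↔ v i = v j * v k := by
  simp [mulFormula]

@[simp]
theorem realize_weakLeFormula (x g : ℕ) (v : ℕ → M) :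
    (weakLeFormula x g).Realize v ↔ WeakLe (prec M) (v x) (v g) := by
  simp [weakLeFormula, WeakLe, IsRightId, eq_comm]

@[simp]
theorem realize_predClosedFormula (g : ℕ) (v : ℕ → M) :
    (predClosedFormula g).Realize v ↔ PredClosed (prec M) (v g) := by
  simp [predClosedFormula, PredClosed, Formula.realize_rel₂]

@[simp]
theorem realize_removableFormula (x : ℕ) (v : ℕ → M) :
    (removableFormula x).Realize v ↔ Removable (prec M) (v x) := by
  simp [removableFormula, Removable]

@[simp]
theorem realize_stringLikeFormula (x : ℕ) (v : ℕ → M) :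
    (stringLikeFormula x).Realize v ↔ StringLike (prec M) (v x) := by
  simp [stringLikeFormula, StringLike]

@[simp]
theorem realize_mulClosedFormula (g : ℕ) (v : ℕ → M) :
    (mulClosedFormula g).Realize v ↔ MulClosed (prec M) (v g) := by
  simp [mulClosedFormula, MulClosed]

@[simp]
theorem realize_remoteFormula (x : ℕ) (v : ℕ → M) :
    (remoteFormula x).Realize v ↔ Remote (prec M) (v x) := by
  simp [remoteFormula, Remote]

theorem realize_domainFormula (v : ℕ → M) :
    domainFormula.Realize v ↔ InDomain (prec M) (v 0) := by
  simp [domainFormula, InDomain]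

end DomainFormula

theorem interpretable_IDStar_ID (R : ℕ → Type) : Interpretable (IDStar R) ID := by
  -- The relation symbols do not occur in the axioms of `ID*`, so they may be interpreted as empty.
  refine ⟨relativization domainFormula fun _ => ⊥,
    RelTranslation.isInterpretation_of_isInner _ ?_⟩
  intro M _ hM
  let := toBitMagma PrefixRel M
  have := isCompatible_toBitMagma PrefixRel M
  obtain ⟨_, hle⟩ := model_ID_iff.1 hM
  let N : Type := {x : M // InDomain (prec M) x}
  let : BitMagma N :=
    { mul := fun x y => ⟨x.1 * y.1, x.2.mul y.2⟩
      bit := fun c => ⟨BitMagma.bit c, isStd_inDomain hle (isStd_bit c)⟩ }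
  have hcoe : ∀ x y : N, (x * y).1 = x.1 * y.1 := fun _ _ => rfl
  have : BitSemigroup N :=
    ⟨fun x y z => Subtype.ext (assoc x.1 y.1 z.1),
      fun x y c h => Subtype.ext (cancel x.1 y.1 c (congrArg Subtype.val h)),
      fun x y h => BitSemigroup.ne x.1 y.1 (congrArg Subtype.val h)⟩
  have hval : ∀ l : List Bool, l ≠ [] → (val l : N).1 = val l := by
    intro l hl
    induction l, hl using string_induction with
    | single c => rfl
    | concat l c hl ih => rw [val_concat hl, val_concat hl, hcoe, ih]; rfl
  -- Being a biteral means the same in the domain and in `M`, so the factor property of the domain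
  -- becomes a statement about `N` alone.
  have hstd : ∀ x : N, IsStd N x ↔ IsStd M x.1 := by
    refine fun x => exists_congr fun l => and_congr_right fun hl => ?_
    rw [← hval l hl]
    exact Subtype.ext_iff
  let S : (concatLang R).Structure N := toStructure fun _ _ => False
  have hS : IsCompatible R N := isCompatible_toStructure _
  refine ⟨N, S, fun a _ => a.1, ⟨BitMagma.bit false⟩,
    model_IDStar_iff.2 ⟨inferInstance, fun l hl x hx => exists_infix_of_isFactor ?_ hl hx⟩,
    isInner_relativization Subtype.val Subtype.val_injective hcoe (fun _ => rfl) ?_ ?_⟩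
  · intro x y h
    rw [hstd, hstd]
    exact x.2.isStd_of_mul hle y.2 ((hstd _).1 h)
  · intro x
    rw [realize_domainFormula]
    exact ⟨fun h => ⟨⟨x, h⟩, rfl⟩, fun ⟨a, ha⟩ => ha ▸ a.2⟩
  · exact fun _ _ => Iff.rfl

end Concat

/-- `ID` and `ID*` are mutually interpretable, whether the language of `ID*` is taken to be
`{0, 1, ∘}` or the language `{0, 1, ∘, ⪯}` of `ID`. -/
theorem mainTheorem2 :
    MutuallyInterpretable ID (IDStar fun _ => Empty) ∧
      MutuallyInterpretable ID (IDStar PrefixRel) :=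
  ⟨⟨Concat.interpretable_ID_IDStar _, Concat.interpretable_IDStar_ID _⟩,
    ⟨Concat.interpretable_ID_IDStar _, Concat.interpretable_IDStar_ID _⟩⟩
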